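/- **Setting.** Let $\mathcal X$ be a finite nonempty data universe. A database is $D\in\mathcal X^n$. A linear query is a function $q:\mathcal X\to[0,1]$; for a finite sequence $E=(e_1,\dots,e_r)$ of elements of $\mathcal X$ put $q(E)=\frac1r\sum_{i=1}^r q(e_i)$, and write $\neg q=1-q$. There are $m$ analysts; analyst $j$ asks a finite set $\mathcal Q_j$ of linear queries. For $\vec{\mathcal Q}=(\mathcal Q_1,\dots,\mathcal Q_m)$ let $\mathcal U=\mathcal U(\vec{\mathcal Q})=\bigcup_j(\mathcal Q_j\cup\neg\mathcal Q_j)$. Two tuples $\vec{\mathcal Q},\vec{\mathcal Q}'$ are query-adjacent at $i$ if $\mathcal Q_j=\mathcal Q'_j$ for all $j\ne i$ and $|\mathcal Q_i\triangle\mathcal Q'_i|\le1$. **Privacy.** A mechanism $\mathcal A$, which on each $D$ and each $\vec{\mathcal Q}$ in a class of admissible inputs gives random outputs $(Z_1,\dots,Z_m)$, is $(\varepsilon,\delta)$-one-query-to-many-analyst private if for every $D$, every $i$, all admissible $\vec{\mathcal Q},\vec{\mathcal Q}'$ query-adjacent at $i$, and every measurable set $S$ of joint outputs to the analysts other than $i$,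 $$\Pr[\mathcal A(D,\vec{\mathcal Q})_{-i}\in S]\le e^{\varepsilon}\,\Pr[\mathcal A(D,\vec{\mathcal Q}')_{-i}\in S]+\delta .$$ **Mechanism.** Fix a size parameter $K\ge 1$ (natural logarithms throughout), put $$T=\lceil n\max\{\log|\mathcal X|,\log K\}\rceil,\qquad \eta=\frac{\varepsilon}{2\sqrt{T\log(1/\delta)}},\qquad s=12T,$$ and fix $\tau\in\mathbb R$, $b_1,b_2>0$. For a measure $A:\mathcal U\to[0,1]$ with $0<\sum_aA(a)\le s\le|\mathcal U|$, let $\Gamma_sA(a)=\min\{1,cA(a)\}$, where $c\ge1$ is such that $\sum_a\min\{1,cA(a)\}=s$; sampling from a measure means sampling from its normalization. Start with the uniform probability measures $D_0$ on $\mathcal X$ and $Q_1$ on $\mathcal U$. For $t=1,\dots,T$: - the query player samples $\hat q_t$ from $\Gamma_sQ_t$; - the data player sets $D_t(x)=D_{t-1}(x)\exp\left(-\eta\,\frac{1+\hat q_t(D)-\hat q_t(x)}2\right)$ for all $x\in\mathcal X$ and samples $\hat x_t$ from $D_t$; - the query player sets $Q_{t+1}(q)=Q_t(q)\exp\left(-\eta\,\frac{1+q(D)-q(\hat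 x_t)}2\right)$ for all $q\in\mathcal U$. Let $\widehat D=(\hat x_1,\dots,\hat x_T)$. Sparse vector flags each $q\in\mathcal U$ with $|q(D)-q(\widehat D)|+z_q\ge\tau$, and the Laplace mechanism gives each flagged $q$ the answer $a_q=q(D)+y_q$, where $z_q\sim\mathrm{Lap}(b_1)$ and $y_q\sim\mathrm{Lap}(b_2)$, $q\in\mathcal U$, are all independent of each other and of the play. Analyst $j$ receives $\widehat D$ and the pairs $(q,a_q)$ for the flagged $q\in\mathcal Q_j$. An input $\vec{\mathcal Q}$ is admissible if $|\mathcal U(\vec{\mathcal Q})|\ge s$. **Theorem.** Let $0<\varepsilon\le1$ and $0<\delta<1$, and let $\tau\in\mathbb R$ and $b_1,b_2>0$ be arbitrary. 1. For every $K$ that is fixed independently of the queries (for instance a public upper bound on $|\mathcal U|$), the mechanism is $(\varepsilon,\delta)$-one-query-to-many-analyst private on the admissible inputs. 2. The mechanism that takes $K=|\mathcal U(\vec{\mathcal Q})|$ from its input is, for every $T_0$, $(\varepsilon,\delta)$-one-query-to-many-analyst private on the admissible inputs for which its number of rounds $T$ equals $T_0$. -/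

import Mathlib

open MeasureTheory

noncomputable section

namespace AnalystPrivacy

/-! ### Databases, linear queries, many-analyst mechanisms -/

/-- A linear query on the data universe `X`, given by a function `X → [0,1]`. -/
abbrev LinearQuery (X : Type*) := X → unitInterval

/-- The negated query `1 - q`. -/
def LinearQuery.neg {X : Type*} (q : LinearQuery X) : LinearQuery X :=
  fun x => unitInterval.symm (q x)

/-- The value `q(D) = (1/n) ∑ i, q (x i)` of a linear query on a database with `n` rows. -/
def LinearQuery.eval {X : Type*} {n : ℕ} (q : LinearQuery X) (D : Fin n → X) : ℝ :=
  (∑ i, (q (D i) : ℝ)) / n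

/-- The query sets of `m` analysts. -/
abbrev QuerySets (m : ℕ) (X : Type*) := Fin m → Finset (LinearQuery X)

open Classical in
/-- The query sets `Q` and `Q'` differ only in the set of analyst `i`, and there in at most one
query. -/
def QueryAdjacentAt {m : ℕ} {X : Type*} (i : Fin m) (Q Q' : QuerySets m X) : Prop :=
  (∀ j, j ≠ i → Q j = Q' j) ∧ (symmDiff (Q i) (Q' i)).card ≤ 1

/-- The outputs given to all analysts other than `i`. -/
def outputsExcept {m : ℕ} {R : Type*} (i : Fin m) (Z : Fin m → R) : {j : Fin m // j ≠ i} → R :=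
  fun j => Z j

/-- `(ε, δ)`-one-query-to-many-analyst privacy of a many-analyst mechanism `A` that is defined on
the inputs whose query sets lie in `dom`; `A D Q` is the joint law of the `m` outputs. -/
def OneQueryToManyAnalystPrivate {m n : ℕ} {X R : Type*} [MeasurableSpace R]
    (dom : Set (QuerySets m X)) (A : (Fin n → X) → QuerySets m X → Measure (Fin m → R))
    (ε δ : ℝ) : Prop :=
  ∀ (D : Fin n → X) (i : Fin m) (Q Q' : QuerySets m X), Q ∈ dom → Q' ∈ dom →
    QueryAdjacentAt i Q Q' →
    ∀ S : Set ({j : Fin m // j ≠ i} → R), MeasurableSet S →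
      (A D Q).map (outputsExcept i) S
        ≤ ENNReal.ofReal (Real.exp ε) * (A D Q').map (outputsExcept i) S + ENNReal.ofReal δ

/-! ### Measures over actions, projection to density-`s` measures -/

open Classical in
/-- The probability distribution of a measure `A` over the finite action set `S`:
the action `a ∈ S` has probability `A a / ∑ b ∈ S, A b`. (If the total mass is `0` the value is an
arbitrary point mass.) -/
def toDistribution {α : Type*} [Nonempty α] (S : Finset α) (A : α → ℝ) : PMF α :=
  let f : α → ENNReal := fun a => if a ∈ S then ENNReal.ofReal (A a) else 0
  if h : (∑' a, f a) ≠ 0 ∧ (∑' a, f a) ≠ ⊤ then PMF.normalize f h.1 h.2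
  else PMF.pure (Classical.arbitrary α)

open Classical in
/-- The Bregman projection of a measure `A` over the action set `S` into the set of density-`s`
measures: `a ↦ min {1, c A(a)}`, where `c ≥ 1` satisfies `∑ a ∈ S, min {1, c A(a)} = s`. -/
def bregmanProj {α : Type*} (S : Finset α) (s : ℝ) (A : α → ℝ) : α → ℝ :=
  if h : ∃ c : ℝ, 1 ≤ c ∧ ∑ a ∈ S, min 1 (c * A a) = s then fun a => min 1 (h.choose * A a)
  else A

/-! ### The offline mechanism -/

open Classical in
/-- The set of all queries of all analysts and of their negations. -/
def allQueries {m : ℕ} {X : Type*} (Q : QuerySets m X) : Finset (LinearQuery X) :=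
  Finset.univ.biUnion fun j => Q j ∪ (Q j).image LinearQuery.neg

/-- The number of rounds, `T = n · max {log N, log K}`, rounded up. -/
def rounds (n N K : ℕ) : ℕ := ⌈(n : ℝ) * max (Real.log N) (Real.log K)⌉₊

/-- The step size `η = ε / (2 √(T log (1/δ)))`. -/
def stepSize (ε δ : ℝ) (T : ℕ) : ℝ := ε / (2 * Real.sqrt (T * Real.log (1 / δ)))

/-- The data player's measure over `X` after receiving the listed queries (latest first). -/
def dataMeasure {X : Type*} [Fintype X] {n : ℕ} (D : Fin n → X) (η : ℝ) :
    List (LinearQuery X) → X → ℝ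
  | [], _ => 1 / Fintype.card X
  | q :: qs, x => dataMeasure D η qs x * Real.exp (-η * ((1 + q.eval D - q x) / 2))

/-- The query player's (unprojected) measure over the query set `U` after receiving the listed
data elements (latest first). -/
def queryMeasure {X : Type*} {n : ℕ} (D : Fin n → X) (U : Finset (LinearQuery X)) (η : ℝ) :
    List X → LinearQuery X → ℝ
  | [], _ => 1 / U.card
  | x :: xs, q => queryMeasure D U η xs q * Real.exp (-η * ((1 + q.eval D - q x) / 2))

/-- The joint law of the queries and the data elements (latest first) chosen in `t` rounds of play.
In each round the query player samples from the projection of its measure, the data player updates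
on that query and samples a data element, on which the query player then updates. -/
def play {X : Type*} [Fintype X] [Nonempty X] {n : ℕ} (D : Fin n → X)
    (U : Finset (LinearQuery X)) (η s : ℝ) : ℕ → PMF (List (LinearQuery X) × List X)
  | 0 => PMF.pure ([], [])
  | t + 1 =>
    (play D U η s t).bind fun h =>
      (toDistribution U (bregmanProj U s (queryMeasure D U η h.2))).bind fun q =>
        (toDistribution Finset.univ (dataMeasure D η (q :: h.1))).bind fun x =>
          PMF.pure (q :: h.1, x :: h.2)

/-- The published sequence of data elements. Every set of synopses is an event. -/
def Synopsis (X : Type*) := List X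

instance {X : Type*} : MeasurableSpace (Synopsis X) := ⊤

/-- The value of a linear query on a synopsis, i.e. its average over the sequence. -/
def LinearQuery.evalSynopsis {X : Type*} (q : LinearQuery X) (H : Synopsis X) : ℝ :=
  q.eval (fun i => List.get H i)

/-- The law of the synopsis `(x₁, …, x_T)` produced by `T` rounds of play. -/
def synopsisLaw {X : Type*} [Fintype X] [Nonempty X] {n : ℕ} (D : Fin n → X)
    (U : Finset (LinearQuery X)) (η s : ℝ) (T : ℕ) : PMF (Synopsis X) :=
  (play D U η s T).map fun h => (h.2.reverse : List X)

/-- The centred Laplace distribution with scale `b > 0`. -/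
def laplace (b : ℝ) : Measure ℝ :=
  volume.withDensity fun x => ENNReal.ofReal (1 / (2 * b) * Real.exp (-|x| / b))

/-- What one analyst receives: the synopsis and, for each query, either nothing (`Sum.inl ()`) or
an additional answer `a` (`Sum.inr a`). -/
abbrev AnalystOutput (X : Type*) := Synopsis X × (LinearQuery X → Unit ⊕ ℝ)

open Classical in
/-- The outputs to all analysts, given the synopsis `H` and the pair `z q` of noise values for each
query `q`. Sparse vector flags `q` if its noisy error `|q(D) - q(H)| + (z q).1` is at least `τ`;
the Laplace mechanism answers a flagged query with `q(D) + (z q).2`, and the answer goes to the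
analysts that issued `q`. -/
def release {m n : ℕ} {X : Type*} (D : Fin n → X) (Q : QuerySets m X) (τ : ℝ)
    (H : Synopsis X) (z : {q // q ∈ allQueries Q} → ℝ × ℝ) : Fin m → AnalystOutput X :=
  fun j => (H, fun q =>
    if h : q ∈ Q j then
      let w : ℝ × ℝ := z ⟨q, Finset.mem_biUnion.2
        ⟨j, Finset.mem_univ j, Finset.mem_union_left _ h⟩⟩
      if τ ≤ |q.eval D - q.evalSynopsis H| + w.1 then Sum.inr (q.eval D + w.2)
      else Sum.inl ()
    else Sum.inl ())

/-- The offline mechanism for linear queries: the joint law of the outputs to the `m` analysts on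
the database `D` and the query sets `Q`. The number of rounds is `T = rounds n |X| K`, the density
is `s = 12 T`; `τ` and `b₁` are the threshold and the noise scale of sparse vector, and `b₂` is the
noise scale of the Laplace mechanism. All noise is independent. -/
def offlineMechanism {m n : ℕ} {X : Type*} [Fintype X] [Nonempty X] (K : ℕ) (ε δ τ b₁ b₂ : ℝ)
    (D : Fin n → X) (Q : QuerySets m X) : Measure (Fin m → AnalystOutput X) :=
  let T := rounds n (Fintype.card X) K
  ((synopsisLaw D (allQueries Q) (stepSize ε δ T) (12 * T) T).toMeasure.prod
    (Measure.pi fun _ : {q // q ∈ allQueries Q} => (laplace b₁).prod (laplace b₂))).map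
    fun p => release D Q τ p.1 p.2

end AnalystPrivacy

end

noncomputable section

namespace AnalystPrivacy

open scoped ENNReal

/-! Only the synopsis depends on the changed query: given the synopsis, what the other analysts see
is post-processing by their own unchanged queries and fresh noise. So it suffices to compare the
synopsis laws for nested `U ⊆ U'` differing by at most two queries (one query and its negation).

Query player. Projected measures have total mass `s` and values at most `1`, so two extra queries
can take away at most `2 / s = 1 / (6 T)` of the probability (`exists_common_component`). In each
round the two queries can be coupled to agree except with probability `ρ = 1 / (6 T)`.

Data player. Let `k` be the number of coupled disagreements and `R` the likelihood ratio of the data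
elements, second play against first. Each disagreement shifts the log-density of the data player by
at most `η / 2` up to normalization, so Hoeffding's lemma controls the negative moments of `R`
(`mean_ratio_rpow_le`).

Combination (`mean_adaptivePlay_le`). Every disagreement is charged a factor `w = exp (3 ε / 2)`. On
`w ^ k * R ≥ 1` a test `g` is at most `w ^ k * R * g`, whose mean is exactly `(1 - ρ + ρ w) ^ T ≤
exp ε` times the mean of `g` in the second play. The complement forces `k ≥ 1`; Markov's inequality
with an exponent proportional to `1 / k` bounds its probability given `k` by `δ * exp (k / 32)`.
Disagreements occur independently of the history, so the generating function of `k` bounds the total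
by `δ`. -/

/-! ### Expectations under a probability mass function -/

/-- The expectation of a nonnegative function under a probability mass function. -/
def mean {α : Type*} (p : PMF α) (f : α → ℝ≥0∞) : ℝ≥0∞ := ∑' a, p a * f a

section mean

variable {α β : Type*}

lemma mean_mono (p : PMF α) {f g : α → ℝ≥0∞} (h : ∀ a, f a ≤ g a) : mean p f ≤ mean p g :=
  ENNReal.tsum_le_tsum fun a => mul_le_mul_right (h a) _

lemma mean_const (p : PMF α) (c : ℝ≥0∞) : mean p (fun _ => c) = c := by
  simp [mean, ENNReal.tsum_mul_right, p.tsum_coe]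

lemma mean_add (p : PMF α) (f g : α → ℝ≥0∞) :
    mean p (fun a => f a + g a) = mean p f + mean p g := by
  simp [mean, mul_add, ENNReal.tsum_add]

lemma mean_const_mul (p : PMF α) (c : ℝ≥0∞) (f : α → ℝ≥0∞) :
    mean p (fun a => c * f a) = c * mean p f := by
  simp only [mean, ← ENNReal.tsum_mul_left]
  exact tsum_congr fun a => by ring

lemma mean_tsum (p : PMF α) (f : β → α → ℝ≥0∞) :
    mean p (fun a => ∑' b, f b a) = ∑' b, mean p (f b) := by
  simp only [mean, ← ENNReal.tsum_mul_left]
  exact ENNReal.tsum_comm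

lemma mean_pure (a : α) (f : α → ℝ≥0∞) : mean (PMF.pure a) f = f a := by
  classical
  rw [mean, tsum_eq_single a]
  · simp
  · intro b hb
    simp [PMF.pure_apply, hb]

lemma mean_bind (p : PMF α) (k : α → PMF β) (f : β → ℝ≥0∞) :
    mean (p.bind k) f = mean p (fun a => mean (k a) f) := by
  simp only [mean, PMF.bind_apply, ← ENNReal.tsum_mul_right, ← ENNReal.tsum_mul_left]
  rw [ENNReal.tsum_comm]
  exact tsum_congr fun a => tsum_congr fun b => by ring

lemma mean_map (p : PMF α) (k : α → β) (f : β → ℝ≥0∞) :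
    mean (p.map k) f = mean p (fun a => f (k a)) := by
  rw [PMF.map, mean_bind]
  exact congrArg _ (funext fun a => by simp [mean_pure])

end mean

/-! ### Adaptive play and its couplings -/

section adaptive

variable {A B X : Type*}

/-- Alternating play of a query player with kernel `κ`, which sees the data elements, and a data
player with kernel `D`, which sees the queries. Histories are listed latest first. -/
def adaptivePlay (κ : List X → PMF A) (D : List A → PMF X) : ℕ → PMF (List A × List X)
  | 0 => PMF.pure ([], [])
  | t + 1 => (adaptivePlay κ D t).bind fun h => (κ h.2).bind fun q =>
      (D (q :: h.1)).bind fun x => PMF.pure (q :: h.1, x :: h.2)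

lemma mean_adaptivePlay_zero (κ : List X → PMF A) (D : List A → PMF X)
    (F : List A × List X → ℝ≥0∞) : mean (adaptivePlay κ D 0) F = F ([], []) :=
  mean_pure _ _

lemma mean_adaptivePlay_succ (κ : List X → PMF A) (D : List A → PMF X) (t : ℕ)
    (F : List A × List X → ℝ≥0∞) :
    mean (adaptivePlay κ D (t + 1)) F =
      mean (adaptivePlay κ D t) fun h => mean (κ h.2) fun q =>
        mean (D (q :: h.1)) fun x => F (q :: h.1, x :: h.2) := by
  simp only [adaptivePlay, mean_bind, mean_pure]

/-- The data player of the coupled play reads only first components, so forgetting the second ones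
loses nothing. -/
lemma mean_adaptivePlay_map {κ : List X → PMF B} {p : List X → PMF A} (D : List A → PMF X)
    (fst : B → A) (hκ : ∀ xs F, mean (κ xs) (fun e => F (fst e)) = mean (p xs) F)
    (t : ℕ) (G : List A × List X → ℝ≥0∞) :
    mean (adaptivePlay κ (fun es => D (es.map fst)) t) (fun h => G (h.1.map fst, h.2)) =
      mean (adaptivePlay p D t) G := by
  induction t generalizing G with
  | zero => simp [mean_adaptivePlay_zero]
  | succ t ih =>
    rw [mean_adaptivePlay_succ, mean_adaptivePlay_succ, ← ih]
    refine congrArg _ (funext fun h => ?_)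
    simp only [List.map_cons]
    exact hκ h.2 fun q => mean (D (q :: h.1.map fst)) fun x => G (q :: h.1.map fst, x :: h.2)

/-- The likelihood ratio of the data elements `xs` for the second against the first components
of the coupled queries `es`. -/
def likelihoodRatio (D : List A → PMF X) (fst snd : B → A) : List B → List X → ℝ≥0∞
  | e :: es, x :: xs => likelihoodRatio D fst snd es xs *
      (D ((e :: es).map snd) x / D ((e :: es).map fst) x)
  | _, _ => 1

/-- The total of the weights `bad e` along a list. -/
def badCount (bad : B → ℕ) (es : List B) : ℕ := (es.map bad).sum

lemma badCount_cons (bad : B → ℕ) (e : B) (es : List B) :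
    badCount bad (e :: es) = bad e + badCount bad es := by
  simp [badCount]

/-- Exact change of measure, round by round: the ratio factor turns sampling by the first query
history into sampling by the second, and the weight `w` on disagreements corrects the second
marginal of the coupling at cost `M`. Division is harmless because the data player has full support.
-/
lemma mean_likelihoodRatio {κ : List X → PMF B} {p : List X → PMF A} {D : List A → PMF X}
    (hD : ∀ qs x, D qs x ≠ 0) (fst snd : B → A) (bad : B → ℕ) (w M : ℝ≥0∞)
    (hκ : ∀ xs F, mean (κ xs) (fun e => w ^ bad e * F (snd e)) = M * mean (p xs) F)
    (t : ℕ) (G : List A × List X → ℝ≥0∞) :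
    mean (adaptivePlay κ (fun es => D (es.map fst)) t) (fun h =>
        w ^ badCount bad h.1 * likelihoodRatio D fst snd h.1 h.2 * G (h.1.map snd, h.2)) =
      M ^ t * mean (adaptivePlay p D t) G := by
  induction t generalizing G with
  | zero => simp [mean_adaptivePlay_zero, likelihoodRatio, badCount]
  | succ t ih =>
    rw [mean_adaptivePlay_succ, mean_adaptivePlay_succ, pow_succ, mul_assoc, ← mean_const_mul,
      ← ih]
    refine congrArg _ (funext fun h => ?_)
    dsimp only
    rw [← hκ h.2 fun q => mean (D (q :: h.1.map snd)) fun x => G (q :: h.1.map snd, x :: h.2),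
      ← mean_const_mul]
    refine congrArg _ (funext fun e => ?_)
    rw [← mean_const_mul, ← mean_const_mul, mean, mean]
    refine tsum_congr fun x => ?_
    have h0 := hD ((e :: h.1).map fst) x
    have h1 : D ((e :: h.1).map fst) x ≠ ∞ := PMF.apply_ne_top _ _
    have h2 := ENNReal.mul_div_cancel (b := D ((e :: h.1).map snd) x) h0 h1
    simp only [List.map_cons] at h2
    simp only [badCount_cons, pow_add, likelihoodRatio, List.map_cons]
    conv_rhs => rw [← h2]
    ring

lemma likelihoodRatio_ne_zero {D : List A → PMF X} (hD : ∀ qs x, D qs x ≠ 0) (fst snd : B → A)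
    (es : List B) (xs : List X) : likelihoodRatio D fst snd es xs ≠ 0 := by
  induction es generalizing xs with
  | nil => simp [likelihoodRatio]
  | cons e es ih =>
    cases xs with
    | nil => simp [likelihoodRatio]
    | cons x xs =>
      exact mul_ne_zero (ih xs) (ENNReal.div_ne_zero.2 ⟨hD _ _, PMF.apply_ne_top _ _⟩)

lemma likelihoodRatio_eq_one {D : List A → PMF X} (hD : ∀ qs x, D qs x ≠ 0) {fst snd : B → A}
    {bad : B → ℕ} (hbad : ∀ e, bad e = 0 → fst e = snd e)
    (es : List B) (xs : List X) (h : badCount bad es = 0) :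
    likelihoodRatio D fst snd es xs = 1 := by
  have key : ∀ es : List B, badCount bad es = 0 → es.map fst = es.map snd := by
    intro es h
    refine List.map_congr_left fun e he => hbad e ?_
    exact List.sum_eq_zero_iff.1 h _ (List.mem_map_of_mem he)
  induction es generalizing xs with
  | nil => simp [likelihoodRatio]
  | cons e es ih =>
    cases xs with
    | nil => simp [likelihoodRatio]
    | cons x xs =>
      rw [likelihoodRatio, key _ h, ENNReal.div_self (hD _ _) (PMF.apply_ne_top _ _), mul_one]
      exact ih xs (by rw [badCount_cons] at h; omega)

/-- The moment bound `c` is available only while at most `K` disagreements have occurred. Counts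
never decrease, so a weight `f` vanishing beyond `K` confines every prefix to that range. The last
round is integrated out first; as the law of its flag ignores the history, this replaces `f` by its
average `f'` over one more flag. -/
lemma mean_likelihoodRatio_rpow_le {κ : List X → PMF B} {D : List A → PMF X}
    (hD : ∀ qs x, D qs x ≠ 0) (fst snd : B → A) (bad : B → ℕ) (β : PMF ℕ)
    (hβ : ∀ xs f, mean (κ xs) (fun e => f (bad e)) = mean β f) (K : ℕ) (α : ℝ) (c : ℝ≥0∞)
    (hc : ∀ es, badCount bad es ≤ K → mean (D (es.map fst))
      (fun x => (D (es.map snd) x / D (es.map fst) x) ^ (-α)) ≤ c)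
    (t : ℕ) (f : ℕ → ℝ≥0∞) (hf : ∀ k, K < k → f k = 0) :
    mean (adaptivePlay κ (fun es => D (es.map fst)) t) (fun h =>
        f (badCount bad h.1) * likelihoodRatio D fst snd h.1 h.2 ^ (-α)) ≤
      c ^ t * mean (adaptivePlay κ (fun es => D (es.map fst)) t)
        (fun h => f (badCount bad h.1)) := by
  induction t generalizing f with
  | zero => simp [mean_adaptivePlay_zero, likelihoodRatio]
  | succ t ih =>
    set f' : ℕ → ℝ≥0∞ := fun k => mean β fun j => f (j + k) with hf'
    have h0 : ∀ k, K < k → f' k = 0 := by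
      intro k hk
      have : (fun j => f (j + k)) = fun _ => 0 := funext fun j => hf _ (by omega)
      rw [hf']
      simp only [this, mean_const]
    have h1 : mean (adaptivePlay κ (fun es => D (es.map fst)) (t + 1))
        (fun h => f (badCount bad h.1)) = mean (adaptivePlay κ (fun es => D (es.map fst)) t)
        (fun h => f' (badCount bad h.1)) := by
      rw [mean_adaptivePlay_succ]
      refine congrArg _ (funext fun h => ?_)
      simp only [badCount_cons, mean_const]
      exact hβ h.2 fun j => f (j + badCount bad h.1)
    rw [h1, pow_succ', mul_assoc]
    refine le_trans ?_ (mul_le_mul_right (ih f' h0) c)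
    rw [mean_adaptivePlay_succ, ← mean_const_mul]
    refine mean_mono _ fun h => ?_
    rw [hf']
    dsimp only
    rw [← hβ h.2, mul_comm (mean _ _), ← mean_const_mul, ← mean_const_mul]
    refine mean_mono _ fun e => ?_
    simp only [badCount_cons]
    by_cases hK : bad e + badCount bad h.1 ≤ K
    · have h2 := hc (e :: h.1) (by rwa [badCount_cons])
      have h3 : ∀ x, likelihoodRatio D fst snd (e :: h.1) (x :: h.2) ^ (-α) =
          likelihoodRatio D fst snd h.1 h.2 ^ (-α) *
          (D ((e :: h.1).map snd) x / D ((e :: h.1).map fst) x) ^ (-α) := by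
        intro x
        rw [likelihoodRatio, ENNReal.mul_rpow_of_ne_zero (likelihoodRatio_ne_zero hD _ _ _ _)
          (ENNReal.div_ne_zero.2 ⟨hD _ _, PMF.apply_ne_top _ _⟩)]
      simp only [h3, mean_const_mul]
      calc _ ≤ f (bad e + badCount bad h.1) * (likelihoodRatio D fst snd h.1 h.2 ^ (-α) * c) := by
            gcongr
        _ = _ := by ring
    · simp [hf _ (not_le.1 hK), mean_const]

/-- The flags are independent with law `β` whatever the history, so the generating function
factorizes. -/
lemma mean_pow_badCount {κ : List X → PMF B} (D : List B → PMF X) (bad : B → ℕ) (β : PMF ℕ)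
    (hβ : ∀ xs f, mean (κ xs) (fun e => f (bad e)) = mean β f) (y : ℝ≥0∞) (t : ℕ) :
    mean (adaptivePlay κ D t) (fun h => y ^ badCount bad h.1) = mean β (fun j => y ^ j) ^ t := by
  induction t with
  | zero => simp [mean_adaptivePlay_zero, badCount]
  | succ t ih =>
    rw [mean_adaptivePlay_succ, pow_succ', ← ih, ← mean_const_mul]
    refine congrArg _ (funext fun h => ?_)
    simp only [badCount_cons, mean_const, pow_add]
    rw [mul_comm, ← mean_const_mul, ← hβ h.2]
    simp only [mul_comm]

end adaptive

/-! ### Likelihood ratios of nearby distributions -/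

lemma mean_eq_ofReal_sum {X : Type*} [Fintype X] (p : PMF X) {f : X → ℝ} (hf : ∀ x, 0 ≤ f x) :
    mean p (fun x => ENNReal.ofReal (f x)) = ENNReal.ofReal (∑ x, (p x).toReal * f x) := by
  rw [mean, tsum_fintype, ENNReal.ofReal_sum_of_nonneg
    fun x _ => mul_nonneg ENNReal.toReal_nonneg (hf x)]
  refine Finset.sum_congr rfl fun x _ => ?_
  rw [ENNReal.ofReal_mul ENNReal.toReal_nonneg, ENNReal.ofReal_toReal (PMF.apply_ne_top _ _)]

/-- **Hoeffding's lemma** for a probability mass function on a finite type. -/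
lemma sum_exp_le_of_abs_le {X : Type*} [Fintype X] (p : PMF X) {h : X → ℝ} {r : ℝ}
    (hr : ∀ x, |h x| ≤ r) (u : ℝ) :
    ∑ x, (p x).toReal * Real.exp (u * h x) ≤
      Real.exp (u * ∑ x, (p x).toReal * h x + u ^ 2 * r ^ 2 / 2) := by
  let _ : MeasurableSpace X := ⊤
  have _ : MeasurableSingletonClass X := ⟨fun _ => trivial⟩
  have hr0 : 0 ≤ r := by
    obtain ⟨x, _⟩ := p.support_nonempty
    exact (abs_nonneg _).trans (hr x)
  have hs := ProbabilityTheory.hasSubgaussianMGF_of_mem_Icc (μ := p.toMeasure) (X := h)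
    (a := -r) (b := r) (measurable_of_finite h).aemeasurable
    (Filter.Eventually.of_forall fun x => abs_le.1 (hr x))
  have h1 := hs.mgf_le u
  rw [ProbabilityTheory.mgf, PMF.integral_eq_sum, PMF.integral_eq_sum] at h1
  simp only [smul_eq_mul] at h1
  set μ := ∑ x, (p x).toReal * h x
  have h2 : ∀ x, (p x).toReal * Real.exp (u * h x) =
      Real.exp (u * μ) * ((p x).toReal * Real.exp (u * (h x - μ))) := by
    intro x
    rw [mul_sub, Real.exp_sub]
    field_simp
  simp only [h2, ← Finset.mul_sum]
  rw [Real.exp_add]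
  refine mul_le_mul_of_nonneg_left (h1.trans (Real.exp_le_exp.2 (le_of_eq ?_)))
    (Real.exp_nonneg _)
  simp only [sub_neg_eq_add, NNReal.coe_pow, NNReal.coe_div, coe_nnnorm, Real.norm_eq_abs,
    NNReal.coe_ofNat]
  rw [abs_of_nonneg (by positivity)]
  ring

/-- The moment equals `C ^ α` times the `P`-mean of `exp (α h)`. Hoeffding's lemma bounds both
factors, and the two terms in the mean of `h` cancel, leaving the variance terms `α r² / 2` and `α²
r² / 2`. -/
lemma mean_ratio_rpow_le {X : Type*} [Fintype X] {P Q : PMF X} {C r α : ℝ} {h : X → ℝ}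
    (hC : 0 < C) (hα : 0 ≤ α) (hr : ∀ x, |h x| ≤ r) (hQ : ∀ x, Q x ≠ 0)
    (hPQ : ∀ x, (P x).toReal = C * (Q x).toReal * Real.exp (h x)) :
    mean P (fun x => (Q x / P x) ^ (-α)) ≤ ENNReal.ofReal (Real.exp (α * (α + 1) * r ^ 2 / 2)) := by
  have hQ' : ∀ x, 0 < (Q x).toReal := fun x => ENNReal.toReal_pos (hQ x) (PMF.apply_ne_top _ _)
  have hP' : ∀ x, 0 < (P x).toReal := fun x => by
    rw [hPQ]; exact mul_pos (mul_pos hC (hQ' x)) (Real.exp_pos _)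
  have h1 : ∀ x, (Q x / P x) ^ (-α) = ENNReal.ofReal (C ^ α * Real.exp (α * h x)) := by
    intro x
    have h2 : Q x / P x = ENNReal.ofReal ((C * Real.exp (h x))⁻¹) := by
      rw [← ENNReal.ofReal_toReal (PMF.apply_ne_top Q x),
        ← ENNReal.ofReal_toReal (PMF.apply_ne_top P x), ← ENNReal.ofReal_div_of_pos (hP' x), hPQ]
      congr 1
      have := (hQ' x).ne'
      field_simp
    rw [h2, ENNReal.ofReal_rpow_of_pos (by positivity), Real.rpow_neg (by positivity),
      Real.inv_rpow (by positivity), inv_inv, Real.mul_rpow hC.le (Real.exp_nonneg _),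
      ← Real.exp_mul, mul_comm (h x)]
  simp only [h1]
  rw [mean_eq_ofReal_sum P fun x => by positivity]
  refine ENNReal.ofReal_le_ofReal ?_
  -- Since `Q` has mass one, `C` is the `P`-mean of `exp (-h)`.
  have h3 : C ≤ Real.exp (-1 * ∑ x, (P x).toReal * h x + (-1) ^ 2 * r ^ 2 / 2) := by
    refine le_trans (le_of_eq ?_) (sum_exp_le_of_abs_le P hr (-1))
    have h4 : ∀ x, (P x).toReal * Real.exp (-1 * h x) = C * (Q x).toReal := by
      intro x
      rw [hPQ, mul_assoc, ← Real.exp_add]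
      simp
    have h5 : ∑ x, (Q x).toReal = 1 := by
      have h6 := Q.tsum_coe
      rw [tsum_fintype] at h6
      rw [← ENNReal.toReal_sum fun x _ => PMF.apply_ne_top Q x, h6, ENNReal.toReal_one]
    simp only [h4, ← Finset.mul_sum, h5, mul_one]
  have h6 := Real.rpow_le_rpow hC.le h3 hα
  rw [← Real.exp_mul] at h6
  calc ∑ x, (P x).toReal * (C ^ α * Real.exp (α * h x))
      = C ^ α * ∑ x, (P x).toReal * Real.exp (α * h x) := by
        rw [Finset.mul_sum]
        exact Finset.sum_congr rfl fun x _ => by ring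
    _ ≤ _ := mul_le_mul h6 (sum_exp_le_of_abs_le P hr α)
        (Finset.sum_nonneg fun x _ => by positivity) (Real.exp_nonneg _)
    _ = _ := by
        rw [← Real.exp_add]
        congr 1
        ring

/-! ### Mixtures -/

/-- If `u a ≤ w p`, then `w p` is a mixture of `a` and another distribution. -/
lemma exists_pmf_remainder {A : Type*} {a p : PMF A} {u v : ℝ≥0∞} (hv : v ≠ 0) (hu : u ≠ ∞)
    (hv' : v ≠ ∞) (h : ∀ x, u * a x ≤ (u + v) * p x) :
    ∃ b : PMF A, ∀ x, (u + v) * p x = u * a x + v * b x := by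
  have h1 : ∑' x, ((u + v) * p x - u * a x) = v := by
    refine (ENNReal.add_left_inj hu).1 ?_
    calc _ = ∑' x, ((u + v) * p x - u * a x) + ∑' x, u * a x := by
          rw [ENNReal.tsum_mul_left, PMF.tsum_coe, mul_one]
      _ = ∑' x, (u + v) * p x := by
          rw [← ENNReal.tsum_add]
          exact tsum_congr fun x => tsub_add_cancel_of_le (h x)
      _ = v + u := by rw [ENNReal.tsum_mul_left, PMF.tsum_coe, mul_one, add_comm]
  refine ⟨PMF.normalize (fun x => (u + v) * p x - u * a x) (by rwa [h1]) (by rwa [h1]),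
    fun x => ?_⟩
  rw [PMF.normalize_apply, h1, mul_comm v, mul_assoc, ENNReal.inv_mul_cancel hv hv', mul_one,
    add_tsub_cancel_of_le (h x)]

/-- The first component of a coupled pair, where `Sum.inl a` stands for `(a, a)`. -/
def couplingFst {A : Type*} : A ⊕ A × A → A := Sum.elim id Prod.fst

/-- The second component of a coupled pair, where `Sum.inl a` stands for `(a, a)`. -/
def couplingSnd {A : Type*} : A ⊕ A × A → A := Sum.elim id Prod.snd

/-- Whether a coupled pair may have distinct components. -/
def couplingBad {A : Type*} : A ⊕ A × A → ℕ := Sum.elim (fun _ => 0) (fun _ => 1)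

lemma couplingFst_inl {A : Type*} (a : A) : couplingFst (Sum.inl a) = a := rfl

lemma couplingFst_inr {A : Type*} (a : A × A) : couplingFst (Sum.inr a) = a.1 := rfl

lemma couplingSnd_inl {A : Type*} (a : A) : couplingSnd (Sum.inl a) = a := rfl

lemma couplingSnd_inr {A : Type*} (a : A × A) : couplingSnd (Sum.inr a) = a.2 := rfl

lemma couplingBad_inl {A : Type*} (a : A) : couplingBad (Sum.inl a) = 0 := rfl

lemma couplingBad_inr {A : Type*} (a : A × A) : couplingBad (Sum.inr a) = 1 := rfl

/-- The law of the indicator of an event of probability `ρ`. -/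
def indicatorLaw (ρ : ℝ≥0∞) (hρ : ρ ≤ 1) : PMF ℕ :=
  PMF.ofFinset (fun k => if k = 0 then 1 - ρ else if k = 1 then ρ else 0) {0, 1}
    (by simp [tsub_add_cancel_of_le hρ]) (by intro k hk; simp at hk; simp [hk])

lemma mean_indicatorLaw (ρ : ℝ≥0∞) (hρ : ρ ≤ 1) (f : ℕ → ℝ≥0∞) :
    mean (indicatorLaw ρ hρ) f = (1 - ρ) * f 0 + ρ * f 1 := by
  rw [mean, tsum_eq_sum (s := {0, 1})]
  · simp [indicatorLaw]
  · intro k hk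
    simp at hk
    simp [indicatorLaw, hk]

lemma mean_mixture {A : Type*} (p q : PMF A) (u v : ℝ≥0∞) (f : A → ℝ≥0∞) :
    u * mean p f + v * mean q f = ∑' x, (u * p x + v * q x) * f x := by
  simp only [mean, ← ENNReal.tsum_mul_left, ← ENNReal.tsum_add, add_mul, mul_assoc]

/-- Two distributions with a common component of weight `1 - ρ` have a coupling that is off the
diagonal with weight `ρ`, and whose second marginal is correct after the off-diagonal part has
been reweighted by `w`. -/
lemma exists_weighted_coupling {A : Type*} {p p' a : PMF A} {ρ w : ℝ≥0∞} (hρ0 : ρ ≠ 0)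
    (hρ : ρ ≤ 1) (hw : 1 ≤ w) (hw' : w ≠ ∞) (hp : ∀ x, (1 - ρ) * a x ≤ p x)
    (hp' : ∀ x, (1 - ρ) * a x ≤ p' x) :
    ∃ κ : PMF (A ⊕ A × A), (∀ F, mean κ (fun e => F (couplingFst e)) = mean p F) ∧
      (∀ F, mean κ (fun e => w ^ couplingBad e * F (couplingSnd e)) =
        (1 - ρ + ρ * w) * mean p' F) ∧
      (∀ f, mean κ (fun e => f (couplingBad e)) = mean (indicatorLaw ρ hρ) f) := by
  have hρ' : ρ ≠ ∞ := ne_top_of_le_ne_top ENNReal.one_ne_top hρ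
  have hu : 1 - ρ ≠ ∞ := ENNReal.sub_ne_top ENNReal.one_ne_top
  have hsum : 1 - ρ + ρ = 1 := tsub_add_cancel_of_le hρ
  obtain ⟨b, hb⟩ := exists_pmf_remainder (a := a) (p := p) hρ0 hu hρ'
    (by simpa [hsum] using hp)
  have hw0 : ρ * w ≠ 0 := mul_ne_zero hρ0 (by rintro rfl; simp at hw)
  -- As `w ≥ 1`, the inflated `(1 - ρ + ρ w) p'` still dominates the common part, and what remains
  -- has mass `ρ w`, the reweighted mass of the off-diagonal part.
  obtain ⟨r, hr⟩ := exists_pmf_remainder (a := a) (p := p') hw0 hu (ENNReal.mul_ne_top hρ' hw')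
    (by
      intro x
      refine (hp' x).trans ?_
      calc p' x = (1 - ρ + ρ * 1) * p' x := by rw [mul_one, hsum, one_mul]
        _ ≤ _ := by gcongr)
  simp only [hsum, one_mul] at hb
  -- Off the diagonal the two remainders are drawn independently.
  have key : ∀ F : A ⊕ A × A → ℝ≥0∞, mean ((indicatorLaw ρ hρ).bind fun k =>
      if k = 0 then a.map Sum.inl else b.bind fun y => r.map fun z => Sum.inr (y, z)) F =
      (1 - ρ) * mean a (fun x => F (Sum.inl x)) +
        ρ * mean b (fun y => mean r fun z => F (Sum.inr (y, z))) := by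
    intro F
    rw [mean_bind, mean_indicatorLaw]
    simp [mean_map, mean_bind]
  refine ⟨(indicatorLaw ρ hρ).bind fun k =>
      if k = 0 then a.map Sum.inl else b.bind fun y => r.map fun z => Sum.inr (y, z),
    fun F => ?_, fun F => ?_, fun f => ?_⟩
  · rw [key]
    simp only [couplingFst_inl, couplingFst_inr, mean_const]
    rw [mean_mixture]
    simp only [← hb]
    rfl
  · rw [key]
    simp only [couplingBad_inl, couplingBad_inr, couplingSnd_inl, couplingSnd_inr, mean_const, pow_zero,
      pow_one, one_mul, mean_const_mul]
    rw [← mul_assoc, mean_mixture]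
    simp only [← hr]
    simp only [mul_assoc, ENNReal.tsum_mul_left]
    rfl
  · rw [key]
    simp [couplingBad_inl, couplingBad_inr, mean_const, mean_indicatorLaw]

/-! ### The data player -/

open Classical in
lemma toDistribution_apply {α : Type*} [Nonempty α] {S : Finset α} {A : α → ℝ}
    (hA : ∀ a ∈ S, 0 ≤ A a) (hS : 0 < ∑ a ∈ S, A a) (a : α) :
    toDistribution S A a = if a ∈ S then ENNReal.ofReal (A a / ∑ b ∈ S, A b) else 0 := by
  have h1 : ∑' a, (if a ∈ S then ENNReal.ofReal (A a) else 0) =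
      ENNReal.ofReal (∑ a ∈ S, A a) := by
    rw [tsum_eq_sum (s := S) fun b hb => by simp [hb], ENNReal.ofReal_sum_of_nonneg hA]
    exact Finset.sum_congr rfl fun x hx => by simp [hx]
  have h2 : ENNReal.ofReal (∑ a ∈ S, A a) ≠ 0 := by simpa using hS
  have h3 : (∑' a, (if a ∈ S then ENNReal.ofReal (A a) else 0)) ≠ 0 ∧
      (∑' a, (if a ∈ S then ENNReal.ofReal (A a) else 0)) ≠ ∞ := by
    rw [h1]; exact ⟨h2, ENNReal.ofReal_ne_top⟩
  have h4 : toDistribution S A = PMF.normalize _ h3.1 h3.2 := dif_pos h3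
  rw [h4, PMF.normalize_apply, h1]
  split_ifs with h5
  · rw [ENNReal.ofReal_div_of_pos hS, div_eq_mul_inv]
  · simp

section data

variable {X : Type*} [Fintype X] {n : ℕ} (D : Fin n → X) (η : ℝ)

lemma dataMeasure_pos (qs : List (LinearQuery X)) (x : X) : 0 < dataMeasure D η qs x := by
  induction qs with
  | nil =>
    have : 0 < Fintype.card X := Fintype.card_pos_iff.2 ⟨x⟩
    simp only [dataMeasure]
    positivity
  | cons q qs ih => exact mul_pos ih (Real.exp_pos _)

/-- Agreeing rounds contribute equal factors. In a disagreeing round the terms `q(D)` are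
independent of `x` and go into `C`, which normalization will absorb; only `η / 2 * (q x - q' x)`
enters `h`. -/
lemma exists_dataMeasure_eq (hη : 0 ≤ η)
    (es : List (LinearQuery X ⊕ LinearQuery X × LinearQuery X)) :
    ∃ C > 0, ∃ h : X → ℝ, (∀ x, |h x| ≤ badCount couplingBad es * (η / 2)) ∧
      ∀ x, dataMeasure D η (es.map couplingFst) x =
        C * dataMeasure D η (es.map couplingSnd) x * Real.exp (h x) := by
  induction es with
  | nil => exact ⟨1, one_pos, fun _ => 0, by simp [badCount], by simp⟩
  | cons e es ih =>
    obtain ⟨C, hC, h, hh, hD⟩ := ih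
    cases e with
    | inl q =>
      refine ⟨C, hC, h, by simpa [badCount, couplingBad_inl] using hh, fun x => ?_⟩
      simp only [List.map_cons, dataMeasure, hD x, couplingFst_inl, couplingSnd_inl]
      ring
    | inr qq =>
      obtain ⟨q, q'⟩ := qq
      refine ⟨C * Real.exp (η / 2 * (q'.eval D - q.eval D)), by positivity,
        fun x => h x + η / 2 * (q x - q' x), fun x => ?_, fun x => ?_⟩
      · refine (abs_add_le _ _).trans ?_
        have h1 : |(q x : ℝ) - q' x| ≤ 1 := by
          have := (q x).2; have := (q' x).2
          rw [abs_le]; constructor <;> simp only [Set.mem_Icc] at * <;> linarith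
        rw [abs_mul, abs_of_nonneg (by positivity : 0 ≤ η / 2), badCount_cons]
        have := mul_le_mul_of_nonneg_left h1 (by positivity : 0 ≤ η / 2)
        have := hh x
        simp only [couplingBad_inr, Nat.cast_add, Nat.cast_one] at *
        linarith
      · simp only [List.map_cons, dataMeasure, hD x, couplingFst_inr, couplingSnd_inr]
        rw [Real.exp_add]
        have h2 : Real.exp (-η * ((1 + q.eval D - q x) / 2)) =
            Real.exp (η / 2 * (q'.eval D - q.eval D)) * Real.exp (-η * ((1 + q'.eval D - q' x) / 2))
              * Real.exp (η / 2 * (q x - q' x)) := by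
          rw [← Real.exp_add, ← Real.exp_add]
          congr 1
          ring
        rw [h2]
        ring

variable [Nonempty X]

/-- The distribution from which the data player samples. -/
def dataLaw (qs : List (LinearQuery X)) : PMF X := toDistribution Finset.univ (dataMeasure D η qs)

lemma dataLaw_apply (qs : List (LinearQuery X)) (x : X) :
    dataLaw D η qs x = ENNReal.ofReal (dataMeasure D η qs x / ∑ y, dataMeasure D η qs y) := by
  rw [dataLaw, toDistribution_apply (fun x _ => (dataMeasure_pos D η qs x).le)
    (Finset.sum_pos (fun x _ => dataMeasure_pos D η qs x) Finset.univ_nonempty)]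
  simp

lemma sum_dataMeasure_pos (qs : List (LinearQuery X)) : 0 < ∑ y, dataMeasure D η qs y :=
  Finset.sum_pos (fun x _ => dataMeasure_pos D η qs x) Finset.univ_nonempty

lemma dataLaw_ne_zero (qs : List (LinearQuery X)) (x : X) : dataLaw D η qs x ≠ 0 := by
  rw [dataLaw_apply]
  simpa using div_pos (dataMeasure_pos D η qs x) (sum_dataMeasure_pos D η qs)

lemma dataLaw_toReal (qs : List (LinearQuery X)) (x : X) :
    (dataLaw D η qs x).toReal = dataMeasure D η qs x / ∑ y, dataMeasure D η qs y := by
  rw [dataLaw_apply, ENNReal.toReal_ofReal]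
  exact (div_pos (dataMeasure_pos D η qs x) (sum_dataMeasure_pos D η qs)).le

lemma mean_dataLaw_ratio_rpow_le (hη : 0 ≤ η) {α : ℝ} (hα : 0 ≤ α) {K : ℕ}
    (es : List (LinearQuery X ⊕ LinearQuery X × LinearQuery X))
    (hK : badCount couplingBad es ≤ K) :
    mean (dataLaw D η (es.map couplingFst)) (fun x => (dataLaw D η (es.map couplingSnd) x /
        dataLaw D η (es.map couplingFst) x) ^ (-α)) ≤
      ENNReal.ofReal (Real.exp (α * (α + 1) * (K * η) ^ 2 / 8)) := by
  obtain ⟨C, hC, h, hh, hD⟩ := exists_dataMeasure_eq D η hη es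
  set Z := ∑ y, dataMeasure D η (es.map couplingFst) y with hZ
  set Z' := ∑ y, dataMeasure D η (es.map couplingSnd) y with hZ'
  have hZp : 0 < Z := sum_dataMeasure_pos D η _
  have hZp' : 0 < Z' := sum_dataMeasure_pos D η _
  have h1 : ∀ x, |h x| ≤ K * (η / 2) := fun x => (hh x).trans (by gcongr)
  refine (mean_ratio_rpow_le (C := C * Z' / Z) (by positivity) hα h1
    (fun x => dataLaw_ne_zero D η _ x) fun x => ?_).trans (le_of_eq ?_)
  · rw [dataLaw_toReal, dataLaw_toReal, hD x, ← hZ, ← hZ']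
    field_simp
  · congr 2
    ring

end data

/-! ### The query player -/

lemma bregmanProj_eq {α : Type*} {S : Finset α} {s : ℝ} {A : α → ℝ} (hA : ∀ a ∈ S, 0 < A a)
    (hs : ∑ a ∈ S, A a ≤ s) (hS : s ≤ S.card) :
    ∃ c : ℝ, 1 ≤ c ∧ ∑ a ∈ S, min 1 (c * A a) = s ∧
      bregmanProj S s A = fun a => min 1 (c * A a) := by
  have h : ∃ c : ℝ, 1 ≤ c ∧ ∑ a ∈ S, min 1 (c * A a) = s := by
    -- At this `C` every value is truncated to `1`, so the sum is the cardinality and the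
    -- intermediate value theorem yields `c`.
    set C : ℝ := 1 + ∑ a ∈ S, (A a)⁻¹ with hC
    have hC1 : 1 ≤ C := by
      have := Finset.sum_nonneg fun a ha => (inv_pos.2 (hA a ha)).le
      linarith
    have hcont : ContinuousOn (fun c : ℝ => ∑ a ∈ S, min 1 (c * A a)) (Set.Icc 1 C) := by
      fun_prop
    have h1 : ∑ a ∈ S, min 1 (1 * A a) ≤ s :=
      (Finset.sum_le_sum fun a _ => by simp).trans hs
    have h2 : s ≤ ∑ a ∈ S, min 1 (C * A a) := by
      have h3 : ∀ a ∈ S, min 1 (C * A a) = 1 := by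
        intro a ha
        rw [min_eq_left_iff]
        have h4 : (A a)⁻¹ ≤ C := by
          have := Finset.single_le_sum (fun b hb => (inv_pos.2 (hA b hb)).le) ha
          linarith
        calc (1 : ℝ) = (A a)⁻¹ * A a := (inv_mul_cancel₀ (hA a ha).ne').symm
          _ ≤ C * A a := mul_le_mul_of_nonneg_right h4 (hA a ha).le
      rw [Finset.sum_congr rfl h3]
      simpa using hS
    obtain ⟨c, hc, hc'⟩ := intermediate_value_Icc hC1 hcont ⟨h1, h2⟩
    exact ⟨c, hc.1, hc'⟩
  refine ⟨h.choose, h.choose_spec.1, h.choose_spec.2, ?_⟩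
  rw [bregmanProj, dif_pos h]

/-- The projection of a rescaled measure on a larger set is at most the projection on the
smaller set. -/
lemma min_mul_le_min_mul {α : Type*} {S S' : Finset α} {s c c' κ : ℝ} {A : α → ℝ}
    (hA : ∀ a ∈ S', 0 < A a) (hSS : S ⊆ S') (hκ : 0 ≤ κ) (hc' : 0 ≤ c')
    (h : ∑ a ∈ S, min 1 (c * A a) = s) (h' : ∑ a ∈ S', min 1 (c' * (κ * A a)) = s) :
    ∀ a ∈ S, min 1 (c' * (κ * A a)) ≤ min 1 (c * A a) := by
  intro a ha
  rcases le_total (c' * κ) c with hle | hle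
  · refine min_le_min_left _ ?_
    rw [← mul_assoc]
    exact mul_le_mul_of_nonneg_right hle (hA a (hSS ha)).le
  -- Here the projection on the larger set dominates on `S`, yet its mass there is at most `s`;
  -- hence the two coincide on `S`.
  · have h1 : ∀ b ∈ S, min 1 (c * A b) ≤ min 1 (c' * (κ * A b)) := by
      intro b hb
      refine min_le_min_left _ ?_
      rw [← mul_assoc]
      exact mul_le_mul_of_nonneg_right hle (hA b (hSS hb)).le
    have h2 : ∑ b ∈ S, min 1 (c' * (κ * A b)) ≤ s := by
      rw [← h']
      refine Finset.sum_le_sum_of_subset_of_nonneg hSS fun b hb _ => ?_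
      exact le_min zero_le_one (mul_nonneg hc' (mul_nonneg hκ (hA b hb).le))
    have h3 := (Finset.sum_eq_sum_iff_of_le h1).1
      (le_antisymm (Finset.sum_le_sum h1) (h2.trans h.ge))
    exact (h3 a ha).ge

section query

variable {X : Type*} {n : ℕ} (D : Fin n → X) (η : ℝ)

lemma LinearQuery.eval_nonneg (q : LinearQuery X) : 0 ≤ q.eval D :=
  div_nonneg (Finset.sum_nonneg fun i _ => (q (D i)).2.1) n.cast_nonneg

lemma queryMeasure_pos {U : Finset (LinearQuery X)} (hU : U.Nonempty) (xs : List X)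
    (q : LinearQuery X) : 0 < queryMeasure D U η xs q := by
  induction xs with
  | nil =>
    have : 0 < U.card := hU.card_pos
    simp only [queryMeasure]
    positivity
  | cons x xs ih => exact mul_pos ih (Real.exp_pos _)

lemma queryMeasure_le {U : Finset (LinearQuery X)} (hη : 0 ≤ η) (hU : U.Nonempty) (xs : List X)
    (q : LinearQuery X) : queryMeasure D U η xs q ≤ 1 / U.card := by
  induction xs with
  | nil => exact le_rfl
  | cons x xs ih =>
    refine (mul_le_of_le_one_right (queryMeasure_pos D η hU xs q).le ?_).trans ih
    rw [Real.exp_le_one_iff]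
    have h1 := q.eval_nonneg D
    have h2 := (q x).2.2
    have := mul_nonneg hη (by linarith : 0 ≤ (1 + q.eval D - q x) / 2)
    linarith

/-- The updates do not involve the query set; only the uniform starting value does. This makes
`min_mul_le_min_mul` applicable. -/
lemma queryMeasure_rescale {U U' : Finset (LinearQuery X)} (hU : U.Nonempty) (xs : List X)
    (q : LinearQuery X) :
    queryMeasure D U' η xs q = (U.card / U'.card : ℝ) * queryMeasure D U η xs q := by
  induction xs with
  | nil =>
    have : (U.card : ℝ) ≠ 0 := by exact_mod_cast hU.card_pos.ne'
    simp only [queryMeasure]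
    field_simp
  | cons x xs ih =>
    simp only [queryMeasure, ih]
    ring

/-- The distribution from which the query player samples. -/
def queryLaw (U : Finset (LinearQuery X)) (s : ℝ) (xs : List X) : PMF (LinearQuery X) :=
  toDistribution U (bregmanProj U s (queryMeasure D U η xs))

lemma exists_bregmanProj_queryMeasure (hη : 0 ≤ η) {U : Finset (LinearQuery X)} {s : ℝ}
    (hs : 1 ≤ s) (hU : s ≤ U.card) (xs : List X) :
    ∃ c : ℝ, 1 ≤ c ∧ ∑ q ∈ U, min 1 (c * queryMeasure D U η xs q) = s ∧
      bregmanProj U s (queryMeasure D U η xs) = fun q => min 1 (c * queryMeasure D U η xs q) := by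
  have hU0 : 0 < U.card := by
    have : (0 : ℝ) < U.card := by linarith
    exact_mod_cast this
  have hne : U.Nonempty := Finset.card_pos.1 hU0
  refine bregmanProj_eq (fun q _ => queryMeasure_pos D η hne xs q) (le_trans ?_ hs) hU
  refine (Finset.sum_le_sum fun q _ => queryMeasure_le D η hη hne xs q).trans ?_
  rw [Finset.sum_const, nsmul_eq_mul]
  have : (U.card : ℝ) ≠ 0 := by exact_mod_cast hU0.ne'
  field_simp
  exact le_rfl

/-- The query player's distributions on a query set and on the same set with at most two further
queries have a common component of weight `1 - 2 / s`. -/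
lemma exists_common_component (hη : 0 ≤ η) {U U' : Finset (LinearQuery X)} {s : ℝ} (hs : 2 < s)
    (hU : s ≤ U.card) (hUU : U ⊆ U') (hcard : U'.card ≤ U.card + 2) (xs : List X) :
    ∃ a : PMF (LinearQuery X), (∀ q, (1 - ENNReal.ofReal (2 / s)) * a q ≤ queryLaw D η U s xs q) ∧
      ∀ q, (1 - ENNReal.ofReal (2 / s)) * a q ≤ queryLaw D η U' s xs q := by
  classical
  have hU' : s ≤ U'.card := hU.trans (by exact_mod_cast Finset.card_le_card hUU)
  have hne : U.Nonempty := by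
    have : (0 : ℝ) < U.card := by linarith
    exact Finset.card_pos.1 (by exact_mod_cast this)
  obtain ⟨c, hc, hsum, hproj⟩ := exists_bregmanProj_queryMeasure D η hη (by linarith) hU xs
  obtain ⟨c', hc', hsum', hproj'⟩ := exists_bregmanProj_queryMeasure D η hη (by linarith) hU' xs
  have hpos := fun q => queryMeasure_pos D η hne xs q
  have hpos' := fun q => queryMeasure_pos D η (hne.mono hUU) xs q
  set d : LinearQuery X → ℝ := fun q => min 1 (c * queryMeasure D U η xs q) with hd
  set d' : LinearQuery X → ℝ := fun q => min 1 (c' * queryMeasure D U' η xs q) with hd'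
  have hd0 : ∀ q, 0 ≤ d q := fun q =>
    le_min zero_le_one (mul_nonneg (by linarith) (hpos q).le)
  have hd0' : ∀ q, 0 ≤ d' q := fun q =>
    le_min zero_le_one (mul_nonneg (by linarith) (hpos' q).le)
  have hdd : ∀ q ∈ U, d' q ≤ d q := by
    have h1 : ∀ q, d' q =
        min 1 (c' * ((U.card / U'.card : ℝ) * queryMeasure D U η xs q)) := fun q => by
      rw [hd', ← queryMeasure_rescale D η hne]
    intro q hq
    rw [h1]
    refine min_mul_le_min_mul (fun q _ => hpos q) hUU (by positivity) (by linarith) hsum ?_ q hq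
    rw [← hsum']
    exact Finset.sum_congr rfl fun q _ => (h1 q).symm
  set W := ∑ q ∈ U, d' q with hW
  -- Each of the at most two new queries carries projected mass at most `1`.
  have hWs : s - 2 ≤ W := by
    have h1 : ∑ q ∈ U' \ U, d' q ≤ 2 := by
      calc _ ≤ ∑ q ∈ U' \ U, (1 : ℝ) := Finset.sum_le_sum fun q _ => min_le_left _ _
        _ ≤ 2 := by
          have : (U' \ U).card ≤ 2 := by
            rw [Finset.card_sdiff_of_subset hUU]
            omega
          simpa using (by exact_mod_cast this : ((U' \ U).card : ℝ) ≤ 2)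
    have h2 := Finset.sum_sdiff (f := d') hUU
    linarith
  have hW0 : 0 < W := by linarith
  have hs0 : 0 < s := by linarith
  have key : ∀ q, (1 - 2 / s) * (d' q / W) ≤ d' q / s := by
    intro q
    have h1 : (1 - 2 / s) * (d' q / W) = d' q / s * ((s - 2) / W) := by
      field_simp
    rw [h1]
    exact mul_le_of_le_one_right (div_nonneg (hd0' q) hs0.le) ((div_le_one hW0).2 hWs)
  have hρ : 1 - ENNReal.ofReal (2 / s) = ENNReal.ofReal (1 - 2 / s) := by
    rw [ENNReal.ofReal_sub _ (by positivity), ENNReal.ofReal_one]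
  have hρ0 : 0 ≤ 1 - 2 / s := by
    rw [sub_nonneg, div_le_one hs0]
    exact hs.le
  -- The common component is the projection for `U'`, restricted to `U` and renormalized.
  refine ⟨toDistribution U d', fun q => ?_, fun q => ?_⟩
  · rw [toDistribution_apply (fun q _ => hd0' q) hW0, queryLaw, hproj,
      toDistribution_apply (fun q _ => hd0 q) (by rw [hsum]; exact hs0), hsum, hρ, ← hW]
    split_ifs with hq
    · rw [← ENNReal.ofReal_mul hρ0]
      exact ENNReal.ofReal_le_ofReal ((key q).trans
        (div_le_div_of_nonneg_right (hdd q hq) hs0.le))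
    · simp
  · rw [toDistribution_apply (fun q _ => hd0' q) hW0, queryLaw, hproj',
      toDistribution_apply (fun q _ => hd0' q) (by rw [hsum']; exact hs0), hsum', hρ, ← hW]
    by_cases hq : q ∈ U
    · rw [if_pos hq, if_pos (hUU hq), ← ENNReal.ofReal_mul hρ0]
      exact ENNReal.ofReal_le_ofReal (key q)
    · simp [hq]

end query

/-! ### Privacy of the synopsis -/

/-- Chord bound by convexity, with `exp (3 / 2) ≤ 7`. The slope `6` matches `ρ = 1 / (6 T)`, giving
`(w - 1) / 6 ≤ ε`. -/
lemma exp_three_halves_mul_le {ε : ℝ} (hε : 0 ≤ ε) (hε1 : ε ≤ 1) :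
    Real.exp (3 / 2 * ε) ≤ 1 + 6 * ε := by
  have h1 : Real.exp (3 / 2) ≤ 7 := by
    have h2 : Real.exp (3 / 2) ^ 2 = Real.exp 1 ^ 3 := by
      rw [← Real.exp_nat_mul, ← Real.exp_nat_mul]
      norm_num
    have h3 : Real.exp 1 ^ 3 ≤ 3 ^ 3 := by
      gcongr
      exact Real.exp_one_lt_three.le
    nlinarith [Real.exp_pos (3 / 2)]
  have h4 := convexOn_exp.2 (Set.mem_univ (3 / 2 : ℝ)) (Set.mem_univ 0) hε
    (by linarith : 0 ≤ 1 - ε) (by ring)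
  simp only [smul_eq_mul, mul_zero, add_zero, Real.exp_zero, mul_one] at h4
  rw [mul_comm]
  nlinarith

lemma mixture_pow_le {T : ℕ} (hT : 1 ≤ T) {y : ℝ} (hy : 1 ≤ y) :
    (1 - ENNReal.ofReal (1 / (6 * T)) + ENNReal.ofReal (1 / (6 * T)) * ENNReal.ofReal y) ^ T ≤
      ENNReal.ofReal (Real.exp ((y - 1) / 6)) := by
  have hT' : (1 : ℝ) ≤ T := by exact_mod_cast hT
  have h1 : 1 / (6 * (T : ℝ)) ≤ 1 := by
    rw [div_le_one (by positivity)]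
    linarith
  have h2 : (0 : ℝ) ≤ 1 / (6 * T) := by positivity
  rw [← ENNReal.ofReal_one, ← ENNReal.ofReal_sub _ h2, ← ENNReal.ofReal_mul h2,
    ← ENNReal.ofReal_add (by linarith) (by positivity), ← ENNReal.ofReal_pow]
  · refine ENNReal.ofReal_le_ofReal ?_
    have h3 : 1 - 1 / (6 * (T : ℝ)) + 1 / (6 * T) * y = (y - 1) / (6 * T) + 1 := by ring
    rw [h3]
    calc _ ≤ Real.exp ((y - 1) / (6 * T)) ^ T := by
          have : 0 ≤ (y - 1) / (6 * T) := div_nonneg (by linarith) (by positivity)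
          exact pow_le_pow_left₀ (by linarith) (Real.add_one_le_exp _) T
      _ = _ := by
          rw [← Real.exp_nat_mul]
          congr 1
          field_simp
  · have : 0 ≤ 1 / (6 * (T : ℝ)) * y := by positivity
    linarith

/-- With `l = log (1 / δ)` and exponent `l / (ε k)`, the threshold gains `exp (-3 l / 2)`, while `T
η² = ε² / (4 l)` makes the moments cost only `exp ((l + k ε) / 32)`. -/
lemma exp_loss_le {ε δ : ℝ} (hε : 0 < ε) (hε1 : ε ≤ 1) (hδ : 0 < δ) (hδ1 : δ < 1) {T : ℕ}
    (hT : 1 ≤ T) {k : ℕ} (hk : 1 ≤ k) :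
    (ENNReal.ofReal (Real.exp (3 / 2 * ε)) ^ k) ^ (-(Real.log (1 / δ) / ε / k)) *
      ENNReal.ofReal (Real.exp ((Real.log (1 / δ) / ε / k) * (Real.log (1 / δ) / ε / k + 1) *
        (k * stepSize ε δ T) ^ 2 / 8)) ^ T ≤
      ENNReal.ofReal δ * ENNReal.ofReal (Real.exp (k / 32)) := by
  set l := Real.log (1 / δ) with hl
  have hl0 : 0 < l := Real.log_pos (by rw [lt_div_iff₀ hδ]; linarith)
  have hT' : (0 : ℝ) < T := by exact_mod_cast hT
  have hk' : (0 : ℝ) < k := by exact_mod_cast hk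
  have hδe : δ = Real.exp (-l) := by
    rw [hl, one_div, Real.log_inv, neg_neg, Real.exp_log hδ]
  have hη : stepSize ε δ T ^ 2 = ε ^ 2 / (4 * (T * l)) := by
    rw [stepSize, ← hl, div_pow, mul_pow, Real.sq_sqrt (by positivity)]
    norm_num
  rw [← ENNReal.ofReal_pow (Real.exp_nonneg _), ENNReal.ofReal_rpow_of_pos (by positivity),
    ← ENNReal.ofReal_pow (Real.exp_nonneg _), ← ENNReal.ofReal_mul (by positivity),
    ← ENNReal.ofReal_mul hδ.le]
  refine ENNReal.ofReal_le_ofReal ?_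
  rw [← Real.exp_nat_mul, ← Real.exp_mul, ← Real.exp_nat_mul, ← Real.exp_add]
  rw [mul_pow, hη]
  have h1 : k * (3 / 2 * ε) * -(l / ε / k) +
      T * (l / ε / k * (l / ε / k + 1) * (k ^ 2 * (ε ^ 2 / (4 * (T * l)))) / 8) =
      -(3 / 2) * l + (l + k * ε) / 32 := by
    field_simp
    ring
  rw [h1]
  clear_value l
  rw [hδe, ← Real.exp_add, Real.exp_le_exp]
  have := mul_le_mul_of_nonneg_left hε1 hk'.le
  linarith

lemma one_add_exp_le_three_pow {k : ℕ} (hk : 1 ≤ k) : 1 + Real.exp (k / 32) ≤ 3 ^ k := by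
  have h1 : Real.exp (1 / 32) ≤ 2 := by
    have h2 : Real.exp (1 / 32) ^ 32 = Real.exp 1 := by
      rw [← Real.exp_nat_mul]
      norm_num
    by_contra h3
    have h4 : (2 : ℝ) ^ 32 < Real.exp (1 / 32) ^ 32 := by
      gcongr
      exact not_le.1 h3
    have := Real.exp_one_lt_three
    linarith
  have h5 : Real.exp (k / 32) ≤ 2 ^ k := by
    calc Real.exp (k / 32) = Real.exp (1 / 32) ^ k := by
          rw [← Real.exp_nat_mul]
          congr 1
          ring
      _ ≤ _ := by gcongr
  have h6 : ∀ k : ℕ, (1 : ℝ) + 2 ^ (k + 1) ≤ 3 ^ (k + 1) := by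
    intro k
    induction k with
    | zero => norm_num
    | succ k ih =>
      rw [pow_succ, pow_succ (3 : ℝ)]
      have : (0 : ℝ) < 2 ^ (k + 1) := by positivity
      linarith
  obtain ⟨j, rfl⟩ : ∃ j, k = j + 1 := ⟨k - 1, by omega⟩
  linarith [h6 j]

/-- Two query players whose distributions have a common component of weight `1 - 1 / (6 T)` lead
to `(ε, δ)`-indistinguishable sequences of data elements. -/
lemma mean_adaptivePlay_le {X : Type*} [Fintype X] [Nonempty X] {n : ℕ} (D : Fin n → X)
    {ε δ : ℝ} (hε : 0 < ε) (hε1 : ε ≤ 1) (hδ : 0 < δ) (hδ1 : δ < 1) {T : ℕ} (hT : 1 ≤ T)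
    {p p' : List X → PMF (LinearQuery X)}
    (hp : ∀ xs, ∃ a : PMF (LinearQuery X),
      (∀ q, (1 - ENNReal.ofReal (1 / (6 * T))) * a q ≤ p xs q) ∧
      ∀ q, (1 - ENNReal.ofReal (1 / (6 * T))) * a q ≤ p' xs q)
    {g : List X → ℝ≥0∞} (hg : ∀ xs, g xs ≤ 1) :
    mean (adaptivePlay p (dataLaw D (stepSize ε δ T)) T) (fun h => g h.2) ≤
      ENNReal.ofReal (Real.exp ε) *
        mean (adaptivePlay p' (dataLaw D (stepSize ε δ T)) T) (fun h => g h.2) +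
      ENNReal.ofReal δ := by
  set η := stepSize ε δ T with hη
  have hη0 : 0 ≤ η := div_nonneg hε.le (by positivity)
  set ρ := ENNReal.ofReal (1 / (6 * T)) with hρdef
  have hT' : (1 : ℝ) ≤ T := by exact_mod_cast hT
  have hρ0 : ρ ≠ 0 := by
    rw [hρdef, Ne, ENNReal.ofReal_eq_zero, not_le]
    positivity
  have hρ : ρ ≤ 1 := by
    rw [hρdef, ENNReal.ofReal_le_one, div_le_one (by positivity)]
    linarith
  set w := ENNReal.ofReal (Real.exp (3 / 2 * ε)) with hw
  have hw1 : 1 ≤ w := by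
    rw [hw, ENNReal.one_le_ofReal]
    exact Real.one_le_exp (by positivity)
  have hwtop : w ≠ ∞ := ENNReal.ofReal_ne_top
  have hcoup : ∀ xs, ∃ κ : PMF (LinearQuery X ⊕ LinearQuery X × LinearQuery X),
      (∀ F, mean κ (fun e => F (couplingFst e)) = mean (p xs) F) ∧
      (∀ F, mean κ (fun e => w ^ couplingBad e * F (couplingSnd e)) =
        (1 - ρ + ρ * w) * mean (p' xs) F) ∧
      (∀ f, mean κ (fun e => f (couplingBad e)) = mean (indicatorLaw ρ hρ) f) := by
    intro xs
    obtain ⟨a, ha, ha'⟩ := hp xs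
    exact exists_weighted_coupling hρ0 hρ hw1 hwtop ha ha'
  choose κ hfst hsnd hbad using hcoup
  have hD := dataLaw_ne_zero D η
  set P := adaptivePlay κ (fun es => dataLaw D η (es.map couplingFst)) T with hP
  set R := likelihoodRatio (dataLaw D η) (couplingFst (A := LinearQuery X)) couplingSnd with hR
  set A := Real.log (1 / δ) / ε with hA
  have hA0 : 0 ≤ A :=
    div_nonneg (Real.log_nonneg (by rw [le_div_iff₀ hδ]; linarith)) hε.le
  -- Splitting by the exact count lets the Markov exponent `A / K` depend on it. The term `K = 0`,
  -- where the division is degenerate, is switched off.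
  let f : ℕ → ℕ → ℝ≥0∞ := fun K k => if 1 ≤ K ∧ k = K then 1 else 0
  have hbase : ∀ h : List (LinearQuery X ⊕ LinearQuery X × LinearQuery X) × List X,
      g h.2 ≤ w ^ badCount couplingBad h.1 * R h.1 h.2 * g h.2 +
        ∑' K : ℕ, (w ^ K) ^ (-(A / K)) *
          (f K (badCount couplingBad h.1) * R h.1 h.2 ^ (-(A / K))) := by
    intro h
    set k := badCount couplingBad h.1 with hk
    have hR0 : R h.1 h.2 ≠ 0 := likelihoodRatio_ne_zero hD _ _ _ _
    by_cases h1 : 1 ≤ w ^ k * R h.1 h.2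
    · calc g h.2 = 1 * g h.2 := (one_mul _).symm
        _ ≤ w ^ k * R h.1 h.2 * g h.2 := by gcongr
        _ ≤ _ := le_self_add
    -- Without disagreements `R = 1`, so the threshold cannot fail.
    · have hk1 : 1 ≤ k := by
        by_contra hk0
        have hk0 : k = 0 := by omega
        refine h1 ?_
        rw [hk0, hR, likelihoodRatio_eq_one hD (bad := couplingBad) ?_ _ _ hk0]
        · simp
        · rintro (e | e) he
          · rfl
          · simp [couplingBad_inr] at he
      refine le_trans ?_ le_add_self
      refine le_trans ?_ (ENNReal.le_tsum k)
      have h2 : f k k = 1 := if_pos ⟨hk1, rfl⟩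
      rw [h2, one_mul, ← ENNReal.mul_rpow_of_ne_zero (pow_ne_zero _ ?_) hR0]
      · refine (hg _).trans ?_
        rw [ENNReal.rpow_neg, ENNReal.one_le_inv]
        exact ENNReal.rpow_le_one (not_le.1 h1).le (by positivity)
      · exact (zero_lt_one.trans_le hw1).ne'
  have hterm : ∀ K : ℕ, (w ^ K) ^ (-(A / K)) *
      mean P (fun h => f K (badCount couplingBad h.1) * R h.1 h.2 ^ (-(A / K))) ≤
      ENNReal.ofReal δ * (ENNReal.ofReal (Real.exp (K / 32)) *
        mean P fun h => f K (badCount couplingBad h.1)) := by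
    intro K
    by_cases hK : 1 ≤ K
    · have h1 := mean_likelihoodRatio_rpow_le (D := dataLaw D η) hD couplingFst couplingSnd
        couplingBad (indicatorLaw ρ hρ) hbad K (A / K) _
        (fun es hes => mean_dataLaw_ratio_rpow_le D η hη0 (by positivity) es hes) T (f K)
        (fun k hk => if_neg fun h => by omega)
      refine (mul_le_mul_right h1 _).trans ?_
      rw [← mul_assoc, ← mul_assoc]
      exact mul_le_mul_left (exp_loss_le hε hε1 hδ hδ1 hT hK) _
    · have h2 : ∀ k, f K k = 0 := fun k => if_neg fun h => hK h.1
      simp [h2, mean_const]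
  -- The sum is at most `3 ^ k - 1`, and the mean of `3 ^ k` is at most `exp (1 / 3) ≤ 2`.
  have hcount : mean P (fun h => ∑' K : ℕ, ENNReal.ofReal (Real.exp (K / 32)) *
      f K (badCount couplingBad h.1)) ≤ 1 := by
    have h1 : ∀ k : ℕ, 1 + ∑' K : ℕ, ENNReal.ofReal (Real.exp (K / 32)) * f K k ≤
        ENNReal.ofReal 3 ^ k := by
      intro k
      rw [tsum_eq_single k fun K hK => by simp [f, hK.symm]]
      by_cases hk : 1 ≤ k
      · simp only [f, hk, and_self, if_true, mul_one]
        rw [← ENNReal.ofReal_one, ← ENNReal.ofReal_add zero_le_one (Real.exp_nonneg _),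
          ← ENNReal.ofReal_pow (by norm_num)]
        exact ENNReal.ofReal_le_ofReal (one_add_exp_le_three_pow hk)
      · have : k = 0 := by omega
        simp [f, this]
    have h2 := mean_mono P fun h => h1 (badCount couplingBad h.1)
    rw [mean_add, mean_const, hP, mean_pow_badCount _ _ _ hbad, mean_indicatorLaw, pow_zero,
      pow_one, mul_one] at h2
    have h3 : ENNReal.ofReal (Real.exp ((3 - 1) / 6)) ≤ 1 + 1 := by
      rw [one_add_one_eq_two, ← ENNReal.ofReal_ofNat 2]
      refine ENNReal.ofReal_le_ofReal ?_
      have h4 : Real.exp ((3 - 1) / 6) ^ 3 = Real.exp 1 := by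
        rw [← Real.exp_nat_mul]
        norm_num
      by_contra h5
      have h6 : (2 : ℝ) ^ 3 < Real.exp ((3 - 1) / 6) ^ 3 := by
        gcongr
        exact not_le.1 h5
      have := Real.exp_one_lt_three
      linarith
    exact (ENNReal.add_le_add_iff_left ENNReal.one_ne_top).1
      (h2.trans ((mixture_pow_le hT (by norm_num)).trans h3))
  have hM : (1 - ρ + ρ * w) ^ T ≤ ENNReal.ofReal (Real.exp ε) := by
    refine (mixture_pow_le hT (Real.one_le_exp (by positivity))).trans
      (ENNReal.ofReal_le_ofReal (Real.exp_le_exp.2 ?_))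
    linarith [exp_three_halves_mul_le hε.le hε1]
  rw [← mean_adaptivePlay_map (dataLaw D η) couplingFst hfst T fun h => g h.2]
  refine (mean_mono _ hbase).trans ?_
  rw [mean_add, mean_tsum,
    mean_likelihoodRatio hD couplingFst couplingSnd couplingBad w _ hsnd T fun h => g h.2]
  refine add_le_add (mul_le_mul_left hM _) ?_
  simp only [mean_const_mul]
  refine (ENNReal.tsum_le_tsum hterm).trans ?_
  rw [ENNReal.tsum_mul_left]
  simp only [← mean_const_mul]
  rw [← mean_tsum]
  exact mul_le_of_le_one_right zero_le hcount

/-! ### The mechanism's play as adaptive play -/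

lemma play_eq_adaptivePlay {X : Type*} [Fintype X] [Nonempty X] {n : ℕ} (D : Fin n → X)
    (U : Finset (LinearQuery X)) (η s : ℝ) (t : ℕ) :
    play D U η s t = adaptivePlay (queryLaw D η U s) (dataLaw D η) t := by
  induction t with
  | zero => rfl
  | succ t ih => simp only [play, adaptivePlay, ih, queryLaw, dataLaw]

lemma mean_synopsisLaw {X : Type*} [Fintype X] [Nonempty X] {n : ℕ} (D : Fin n → X)
    (U : Finset (LinearQuery X)) (η s : ℝ) (T : ℕ) (g : Synopsis X → ℝ≥0∞) :
    mean (synopsisLaw D U η s T) g =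
      mean (adaptivePlay (queryLaw D η U s) (dataLaw D η) T)
        (fun h => g (h.2.reverse : List X)) := by
  rw [← play_eq_adaptivePlay]
  exact mean_map (β := Synopsis X) _ _ g

lemma mean_synopsisLaw_le {X : Type*} [Fintype X] [Nonempty X] {n : ℕ} (D : Fin n → X)
    {ε δ : ℝ} (hε : 0 < ε) (hε1 : ε ≤ 1) (hδ : 0 < δ) (hδ1 : δ < 1) {T : ℕ}
    {U U' : Finset (LinearQuery X)} (hU : 12 * T ≤ U.card) (hU' : 12 * T ≤ U'.card)
    (hUU : (U ⊆ U' ∧ U'.card ≤ U.card + 2) ∨ (U' ⊆ U ∧ U.card ≤ U'.card + 2))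
    {g : Synopsis X → ℝ≥0∞} (hg : ∀ H, g H ≤ 1) :
    mean (synopsisLaw D U (stepSize ε δ T) (12 * T) T) g ≤
      ENNReal.ofReal (Real.exp ε) * mean (synopsisLaw D U' (stepSize ε δ T) (12 * T) T) g +
      ENNReal.ofReal δ := by
  rw [mean_synopsisLaw, mean_synopsisLaw]
  -- With no rounds the synopsis is empty on both inputs.
  rcases Nat.eq_zero_or_pos T with rfl | hT
  · rw [mean_adaptivePlay_zero, mean_adaptivePlay_zero]
    refine le_trans ?_ le_self_add
    exact le_mul_of_one_le_left zero_le (ENNReal.one_le_ofReal.2 (Real.one_le_exp hε.le))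
  · refine mean_adaptivePlay_le D hε hε1 hδ hδ1 hT (fun xs => ?_)
      (g := fun xs => g (xs.reverse : List X)) fun xs => hg _
    have hη : 0 ≤ stepSize ε δ T := div_nonneg hε.le (by positivity)
    have hT' : (1 : ℝ) ≤ T := by exact_mod_cast hT
    have hs : (2 : ℝ) < 12 * T := by linarith
    have h1 : (12 * T : ℝ) ≤ U.card := by exact_mod_cast hU
    have h2 : (12 * T : ℝ) ≤ U'.card := by exact_mod_cast hU'
    have h3 : (2 : ℝ) / (12 * T) = 1 / (6 * T) := by
      field_simp
      norm_num
    rw [← h3]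
    -- A common component serves both directions, so adding and removing a query are treated alike.
    rcases hUU with ⟨hsub, hcard⟩ | ⟨hsub, hcard⟩
    · exact exists_common_component D _ hη hs h1 hsub hcard xs
    · obtain ⟨a, ha, ha'⟩ := exists_common_component D _ hη hs h2 hsub hcard xs
      exact ⟨a, ha', ha⟩

/-! ### Adjacent query sets -/

open Classical in
lemma allQueries_subset_and_card_le {m : ℕ} {X : Type*} {i : Fin m} {Q Q' : QuerySets m X}
    (h : ∀ j, j ≠ i → Q j = Q' j) (hi : Q i ⊆ Q' i) (hcard : (Q' i \ Q i).card ≤ 1) :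
    allQueries Q ⊆ allQueries Q' ∧ (allQueries Q').card ≤ (allQueries Q).card + 2 := by
  have hsub : ∀ j, Q j ⊆ Q' j := fun j => by
    by_cases hj : j = i
    · exact hj ▸ hi
    · exact (h j hj).subset
  refine ⟨Finset.biUnion_mono fun j _ =>
    Finset.union_subset_union (hsub j) (Finset.image_subset_image (hsub j)), ?_⟩
  have hnew : allQueries Q' \ allQueries Q ⊆
      (Q' i \ Q i) ∪ (Q' i \ Q i).image LinearQuery.neg := by
    intro q hq
    simp only [allQueries, Finset.mem_sdiff, Finset.mem_biUnion, Finset.mem_univ, true_and,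
      Finset.mem_union, Finset.mem_image, not_exists, not_or, not_and] at hq ⊢
    obtain ⟨⟨j, hj⟩, hn⟩ := hq
    have hji : j = i := by
      by_contra hji
      rw [← h j hji] at hj
      rcases hj with hj | ⟨r, hr, hrq⟩
      · exact (hn j).1 hj
      · exact (hn j).2 r hr hrq
    subst hji
    rcases hj with hj | ⟨r, hr, hrq⟩
    · exact Or.inl ⟨hj, (hn j).1⟩
    · exact Or.inr ⟨r, ⟨hr, fun hr' => (hn j).2 r hr' hrq⟩, hrq⟩
  have h1 := (Finset.card_le_card hnew).trans (Finset.card_union_le _ _)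
  have h2 := Finset.card_image_le (s := Q' i \ Q i) (f := LinearQuery.neg)
  have h3 := Finset.le_card_sdiff (allQueries Q) (allQueries Q')
  omega

lemma QueryAdjacentAt.subset_or_subset {m : ℕ} {X : Type*} {i : Fin m} {Q Q' : QuerySets m X}
    (h : QueryAdjacentAt i Q Q') :
    (allQueries Q ⊆ allQueries Q' ∧ (allQueries Q').card ≤ (allQueries Q).card + 2) ∨
    (allQueries Q' ⊆ allQueries Q ∧ (allQueries Q).card ≤ (allQueries Q').card + 2) := by
  classical
  obtain ⟨h1, h2⟩ := h
  have h3 : (Q i \ Q' i).card + (Q' i \ Q i).card ≤ 1 := by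
    rw [← Finset.card_union_of_disjoint disjoint_sdiff_sdiff]
    convert h2 using 2
    rfl
  by_cases h4 : (Q i \ Q' i).card = 0
  · left
    exact allQueries_subset_and_card_le h1
      (Finset.sdiff_eq_empty_iff_subset.1 (Finset.card_eq_zero.1 h4)) (by omega)
  · right
    exact allQueries_subset_and_card_le (fun j hj => (h1 j hj).symm)
      (Finset.sdiff_eq_empty_iff_subset.1 (Finset.card_eq_zero.1 (by omega))) (by omega)

/-! ### Releasing the answers -/

lemma isProbabilityMeasure_laplace {b : ℝ} (hb : 0 < b) : IsProbabilityMeasure (laplace b) := by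
  have h1 : ∫ x : ℝ, 1 / (2 * b) * Real.exp (-|x| / b) = 1 := by
    rw [integral_comp_abs (f := fun x => 1 / (2 * b) * Real.exp (-x / b)), integral_const_mul]
    have h2 : ∀ x : ℝ, -x / b = (-b⁻¹) * x := fun x => by ring
    simp only [h2]
    rw [integral_exp_mul_Ioi (by simpa using hb)]
    simp only [mul_zero, Real.exp_zero]
    field_simp
  have h3 : Integrable fun x : ℝ => 1 / (2 * b) * Real.exp (-|x| / b) := by
    -- A non-integrable function would have integral `0` by convention, not `1`.
    by_contra h
    rw [integral_undef h] at h1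
    exact zero_ne_one h1
  constructor
  rw [laplace, withDensity_apply _ MeasurableSet.univ, Measure.restrict_univ,
    ← ofReal_integral_eq_lintegral_ofReal h3 (Filter.Eventually.of_forall fun x => by positivity),
    h1, ENNReal.ofReal_one]

lemma toMeasure_prod_apply {α β : Type*} [MeasurableSpace α] [Countable α]
    [MeasurableSingletonClass α] [MeasurableSpace β] (p : PMF α) (ν : Measure β) [SFinite ν]
    {S : Set (α × β)} (hS : MeasurableSet S) :
    p.toMeasure.prod ν S = mean p fun a => ν (Prod.mk a ⁻¹' S) := by
  rw [Measure.prod_apply hS, lintegral_countable', mean]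
  exact tsum_congr fun a => by
    rw [PMF.toMeasure_apply_singleton _ _ (measurableSet_singleton a), mul_comm]

section release

variable {X : Type*} {m n : ℕ}

instance [Finite X] : Countable (Synopsis X) := inferInstanceAs (Countable (List X))

instance : MeasurableSingletonClass (Synopsis X) := ⟨fun _ => trivial⟩

open Classical in
/-- The outputs to all analysts other than `i`, when noise is available for every query. -/
def releaseExcept (D : Fin n → X) (i : Fin m) (Q : {j : Fin m // j ≠ i} → Finset (LinearQuery X))
    (τ : ℝ) (p : Synopsis X × (LinearQuery X → ℝ × ℝ)) : {j : Fin m // j ≠ i} → AnalystOutput X :=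
  fun j => (p.1, fun q =>
    if q ∈ Q j then
      if τ ≤ |q.eval D - q.evalSynopsis p.1| + (p.2 q).1 then Sum.inr (q.eval D + (p.2 q).2)
      else Sum.inl ()
    else Sum.inl ())

lemma outputsExcept_release (D : Fin n → X) (i : Fin m) (Q : QuerySets m X) (τ : ℝ)
    (H : Synopsis X) (z : LinearQuery X → ℝ × ℝ) :
    outputsExcept i (release D Q τ H ((allQueries Q).restrict z)) =
      releaseExcept D i (fun j => Q j) τ (H, z) := by
  funext j
  refine Prod.ext rfl (funext fun q => ?_)
  simp only [outputsExcept, release, releaseExcept]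
  split_ifs <;> first | rfl | contradiction

lemma measurable_releaseExcept [Finite X] (D : Fin n → X) (i : Fin m)
    (Q : {j : Fin m // j ≠ i} → Finset (LinearQuery X)) (τ : ℝ) :
    Measurable (releaseExcept D i Q τ) := by
  refine measurable_from_prod_countable_right fun H => measurable_pi_lambda _ fun j =>
    measurable_const.prodMk (measurable_pi_lambda _ fun q => ?_)
  by_cases hq : q ∈ Q j
  · simp only [hq, if_true]
    refine Measurable.ite (measurableSet_le measurable_const ?_) ?_ measurable_const
    · fun_prop
    · exact measurable_inr.comp (by fun_prop)
  · simp only [hq, if_false]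
    exact measurable_const

lemma measurable_release [Finite X] (D : Fin n → X) (Q : QuerySets m X) (τ : ℝ) :
    Measurable fun p : Synopsis X × ({q // q ∈ allQueries Q} → ℝ × ℝ) =>
      release D Q τ p.1 p.2 := by
  refine measurable_from_prod_countable_right fun H => measurable_pi_lambda _ fun j =>
    measurable_const.prodMk (measurable_pi_lambda _ fun q => ?_)
  by_cases hq : q ∈ Q j
  · simp only [hq, dif_pos]
    refine Measurable.ite (measurableSet_le measurable_const ?_) ?_ measurable_const
    · fun_prop
    · exact measurable_inr.comp (by fun_prop)
  · simp only [hq, dif_neg, not_false_eq_true]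
    exact measurable_const

/-- The noise is indexed by a set that depends on the input. Viewing it as the restriction of one
i.i.d. family over all queries shows that, given the synopsis, the law of the other outputs depends
only on the `Q j` with `j ≠ i`. -/
lemma map_outputsExcept_apply [Finite X] (D : Fin n → X) (i : Fin m) (Q : QuerySets m X) (τ : ℝ)
    (p : PMF (Synopsis X)) (μ : Measure (ℝ × ℝ)) [IsProbabilityMeasure μ]
    {S : Set ({j : Fin m // j ≠ i} → AnalystOutput X)} (hS : MeasurableSet S) :
    ((p.toMeasure.prod (Measure.pi fun _ : {q // q ∈ allQueries Q} => μ)).map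
        fun r => release D Q τ r.1 r.2).map (outputsExcept i) S =
      mean p fun H => Measure.infinitePi (fun _ : LinearQuery X => μ)
        {z | releaseExcept D i (fun j => Q j) τ (H, z) ∈ S} := by
  have hout : Measurable (outputsExcept (R := AnalystOutput X) i) :=
    measurable_pi_lambda _ fun j => measurable_pi_apply _
  have hrel := measurable_release D Q τ
  have hres := Finset.measurable_restrict (X := fun _ : LinearQuery X => ℝ × ℝ) (allQueries Q)
  have hpi : p.toMeasure.prod (Measure.pi fun _ : {q // q ∈ allQueries Q} => μ) =
      (p.toMeasure.prod (Measure.infinitePi fun _ : LinearQuery X => μ)).map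
        (Prod.map id (allQueries Q).restrict) := by
    rw [← Measure.map_prod_map _ _ measurable_id hres, Measure.map_id,
      Measure.infinitePi_map_restrict]
  rw [Measure.map_map hout hrel, hpi,
    Measure.map_map (hout.comp hrel) (measurable_id.prodMap hres)]
  have heq : (outputsExcept i ∘ fun r : Synopsis X × ({q // q ∈ allQueries Q} → ℝ × ℝ) =>
      release D Q τ r.1 r.2) ∘ Prod.map id (allQueries Q).restrict =
      releaseExcept D i (fun j => Q j) τ :=
    funext fun r => outputsExcept_release D i Q τ r.1 r.2
  rw [heq, Measure.map_apply (measurable_releaseExcept D i _ τ) hS,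
    toMeasure_prod_apply _ _ (measurable_releaseExcept D i _ τ hS)]
  rfl

end release

/-- Mechanisms that play the same number `T` of rounds on both inputs are private. -/
lemma offlineMechanism_private {X : Type*} [Fintype X] [Nonempty X] {m n : ℕ} {ε δ : ℝ}
    (hε : 0 < ε) (hε1 : ε ≤ 1) (hδ : 0 < δ) (hδ1 : δ < 1) {τ b₁ b₂ : ℝ} (hb₁ : 0 < b₁)
    (hb₂ : 0 < b₂) (K : QuerySets m X → ℕ) (T : ℕ) :
    OneQueryToManyAnalystPrivate (m := m) (n := n) (X := X)
      {Q | rounds n (Fintype.card X) (K Q) = T ∧ 12 * T ≤ (allQueries Q).card}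
      (fun D Q => offlineMechanism (K Q) ε δ τ b₁ b₂ D Q) ε δ := by
  rintro D i Q Q' ⟨hQT, hQ⟩ ⟨hQT', hQ'⟩ hadj S hS
  have := isProbabilityMeasure_laplace hb₁
  have := isProbabilityMeasure_laplace hb₂
  simp only [offlineMechanism, hQT, hQT']
  rw [map_outputsExcept_apply D i Q τ _ _ hS, map_outputsExcept_apply D i Q' τ _ _ hS]
  -- The post-processing is now the same on both inputs, so its acceptance probability serves as the
  -- test function `g`.
  have h1 : (fun j : {j : Fin m // j ≠ i} => Q j) = fun j : {j : Fin m // j ≠ i} => Q' j :=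
    funext fun j => hadj.1 j j.2
  rw [h1]
  exact mean_synopsisLaw_le D hε hε1 hδ hδ1 hQ hQ' hadj.subset_or_subset fun H => prob_le_one

end AnalystPrivacy

end

theorem mainTheorem3 {X : Type*} [Fintype X] [Nonempty X] (m n : ℕ) (ε δ : ℝ)
    (hε : 0 < ε) (hε1 : ε ≤ 1) (hδ : 0 < δ) (hδ1 : δ < 1)
    (τ b₁ b₂ : ℝ) (hb₁ : 0 < b₁) (hb₂ : 0 < b₂) :
    (∀ K : ℕ,
      AnalystPrivacy.OneQueryToManyAnalystPrivate (m := m) (n := n) (X := X)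
        {Q | 12 * AnalystPrivacy.rounds n (Fintype.card X) K
              ≤ (AnalystPrivacy.allQueries Q).card}
        (AnalystPrivacy.offlineMechanism K ε δ τ b₁ b₂) ε δ) ∧
    (∀ T : ℕ,
      AnalystPrivacy.OneQueryToManyAnalystPrivate (m := m) (n := n) (X := X)
        {Q | AnalystPrivacy.rounds n (Fintype.card X) (AnalystPrivacy.allQueries Q).card = T ∧
              12 * T ≤ (AnalystPrivacy.allQueries Q).card}
        (fun D Q => AnalystPrivacy.offlineMechanism (AnalystPrivacy.allQueries Q).card
          ε δ τ b₁ b₂ D Q) ε δ) := by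
  refine ⟨fun K D i Q Q' hQ hQ' => ?_, fun T => ?_⟩
  · exact AnalystPrivacy.offlineMechanism_private hε hε1 hδ hδ1 hb₁ hb₂ (fun _ => K) _ D i Q Q'
      ⟨rfl, hQ⟩ ⟨rfl, hQ'⟩
  · exact AnalystPrivacy.offlineMechanism_private hε hε1 hδ hδ1 hb₁ hb₂
      (fun Q => (AnalystPrivacy.allQueries Q).card) T
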